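/- Let $2\le n$ and consider the semi-random process on $3$-uniform hypergraphs with $r=2$ random vertices per step. The process starts from the empty hypergraph $H_0$ on the vertex set $[n]=\{1,\dots,n\}$. In each step $t\ge 1$ a $2$-element set $U_t\subseteq[n]$ is chosen uniformly at random, independently of the past; the player then chooses a one-element set $V_t\subseteq[n]$, and the edge $U_t\cup V_t$ is added to $H_{t-1}$ to form $H_t$. Parallel edges and overlapping pairs $(U_t,V_t)$ are allowed, edges being regarded as multisets of vertices. A strategy $\mathcal S$ on $[n]$ specifies, for every $t$ and every history $(U_1,V_1,\dots,U_{t-1},V_{t-1},U_t)$, a probability distribution according to which $V_t$ is chosen. Let $\mathcal P$ be the property of containing a sub-hypergraph isomorphic to the complete $3$-uniform hypergraph $K_6^{(3)}$ on $6$ vertices. For $0<q<1$ let $\tau^{(2)}_{\mathcal P}(\mathcal S,q,n)$ be the least $t\ge 0$ such that $\mathbb P[H_t\in\mathcal P]\ge q$ when the player follows $\mathcal S$ (and $\infty$ if there is no such $t$), let $\tau^{(2)}_{\mathcal P}(q,n)=\inf_{\mathcal S}\tau^{(2)}_{\mathcal P}(\mathcal S,q,n)$, the infimum being over all strategies on $[n]$,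 and define the threshold exponent $$\tau^{(2)}_{\mathcal P}=\lim_{q\to1^-}\ \limsup_{n\to\infty}\frac{\ln\tau^{(2)}_{\mathcal P}(q,n)}{\ln n}\in[-\infty,\infty],$$ where the limit exists because the expression is non-decreasing in $q$. **Proposition.** $\displaystyle \tau^{(2)}_{\mathcal P}\le\frac95$. -/

import Mathlib

open Filter Topology

noncomputable section

namespace SemiRandom

/-- The `k`-element subsets of the vertex set `[n]`, modelled by `Fin n`. -/
abbrev VertexSet (n k : ℕ) : Type := {A : Finset (Fin n) // A.card = k}

/-- The moves played so far, the most recent one first. A move is a pair `(U, V)` made of the random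
`r`-set `U` and of the `(s - r)`-set `V` chosen by the player. -/
abbrev History (r s n : ℕ) : Type := List (VertexSet n r × VertexSet n (s - r))

/-- A (randomized, adaptive) strategy on `[n]`: given the history of the process and the `r`-set
presented in the current round, a distribution over the `(s - r)`-sets. The round number is one more
than the length of the history. -/
abbrev Strategy (r s n : ℕ) : Type :=
  History r s n → VertexSet n r → PMF (VertexSet n (s - r))

/-- A multi-hypergraph on the vertex set `V`: a multiset of edges. Each edge is itself a multiset of
vertices, so that parallel edges and edges with repeated vertices are allowed. -/
abbrev MultiHypergraph (V : Type) : Type := Multiset (Multiset V)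

/-- The multi-hypergraph formed by the edges `U ∪ V` of a history. The union is taken with
multiplicity, so each edge has exactly `s` vertices when `r ≤ s`. -/
def History.graph {r s n : ℕ} (h : History r s n) : MultiHypergraph (Fin n) :=
  (h.map fun m => m.1.1.val + m.2.1.val : List (Multiset (Fin n)))

theorem VertexSet.nonempty {n k : ℕ} (h : k ≤ n) : Nonempty (VertexSet n k) := by
  obtain ⟨A, -, hA⟩ := Finset.exists_subset_card_eq
    (s := (Finset.univ : Finset (Fin n))) (n := k) (by simpa using h)
  exact ⟨⟨A, hA⟩⟩

/-- The uniform distribution on the `k`-subsets of `[n]`. -/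
def uniformVertexSet {n k : ℕ} (h : k ≤ n) : PMF (VertexSet n k) :=
  haveI := VertexSet.nonempty h
  PMF.uniformOfFintype (VertexSet n k)

/-- The law of the history after `t` rounds, when the player follows the strategy `S`. -/
def historyLaw {r s n : ℕ} (hn : r ≤ n) (S : Strategy r s n) : ℕ → PMF (History r s n)
  | 0 => PMF.pure []
  | t + 1 => (historyLaw hn S t).bind fun h =>
      (uniformVertexSet hn).bind fun U =>
        (S h U).bind fun V => PMF.pure ((U, V) :: h)

/-- The law of the random multi-hypergraph `H_t` when the player follows the strategy `S`. -/
def graphLaw {r s n : ℕ} (hn : r ≤ n) (S : Strategy r s n) (t : ℕ) :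
    PMF (MultiHypergraph (Fin n)) :=
  (historyLaw hn S t).map History.graph

/-- A property of multi-hypergraphs on `[n]`, for every `n`. -/
abbrev GraphProperty : Type := ∀ n : ℕ, Set (MultiHypergraph (Fin n))

/-- `τ(S, q, n)`: the least `t` for which `H_t` has the property `P` with probability at least `q`,
and `∞` if there is no such `t`. -/
def hittingTime (P : GraphProperty) {r s n : ℕ} (hn : r ≤ n) (S : Strategy r s n) (q : ℝ) : ℕ∞ :=
  ⨅ (t : ℕ) (_ : ENNReal.ofReal q ≤ (graphLaw hn S t).toOuterMeasure (P n)), (t : ℕ∞)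

/-- `τ(q, n)`: the infimum of `τ(S, q, n)` over all strategies `S` on `[n]`. The value is `∞` for the
finitely many `n < r`, where there is no `r`-subset of `[n]` to be presented. -/
def optimalTime (r s : ℕ) (P : GraphProperty) (q : ℝ) (n : ℕ) : ℕ∞ :=
  ⨅ (hn : r ≤ n) (S : Strategy r s n), hittingTime P hn S q

/-- `limsup_{n → ∞} ln τ(q, n) / ln n`, as an extended real number. -/
def growthExponent (r s : ℕ) (P : GraphProperty) (q : ℝ) : EReal :=
  limsup (fun n : ℕ => ENNReal.log (optimalTime r s P q n : ENNReal) / (Real.log n : EReal)) atTop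

/-- The threshold exponent of the property `P` in the semi-random process on `s`-uniform hypergraphs
with `r` random vertices per round: the limit of `growthExponent` as `q → 1` from below. -/
def thresholdExponent (r s : ℕ) (P : GraphProperty) : EReal :=
  limUnder (𝓝[<] (1 : ℝ)) (growthExponent r s P)

theorem hittingTime_mono (P : GraphProperty) {r s n : ℕ} (hn : r ≤ n) (S : Strategy r s n) :
    Monotone (hittingTime P hn S) := fun _ _ h =>
  le_iInf₂ fun t ht => iInf₂_le t ((ENNReal.ofReal_le_ofReal h).trans ht)

theorem growthExponent_mono (r s : ℕ) (P : GraphProperty) : Monotone (growthExponent r s P) := by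
  intro q₁ q₂ h
  refine limsup_le_limsup (Eventually.of_forall fun n => ?_)
  refine EReal.div_le_div_right_of_nonneg ?_ ?_
  · exact_mod_cast Real.log_natCast_nonneg n
  · refine ENNReal.log_monotone (ENat.toENNReal_le.2 ?_)
    exact iInf₂_mono fun hn S => hittingTime_mono P hn S h

/-- The limit that defines the threshold exponent exists. -/
theorem tendsto_growthExponent (r s : ℕ) (P : GraphProperty) :
    Tendsto (growthExponent r s P) (𝓝[<] (1 : ℝ)) (𝓝 (thresholdExponent r s P)) :=
  tendsto_nhds_limUnder ⟨_, (growthExponent_mono r s P).tendsto_nhdsLT 1⟩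

/-- A (simple) `s`-uniform hypergraph on the vertex set `V`. -/
structure UniformHypergraph (V : Type) (s : ℕ) where
  edges : Finset (Finset V)
  card_eq : ∀ e ∈ edges, e.card = s

/-- The complete `s`-uniform hypergraph on `k` vertices. -/
def clique (k s : ℕ) : UniformHypergraph (Fin k) s where
  edges := Finset.powersetCard s Finset.univ
  card_eq := fun _ he => (Finset.mem_powersetCard.1 he).2

/-- The property of possessing a sub-hypergraph isomorphic to `G`. -/
def containsCopy {V : Type} {s : ℕ} (G : UniformHypergraph V s) : GraphProperty := fun n =>
  {H | ∃ φ : V → Fin n, Function.Injective φ ∧ ∀ e ∈ G.edges, e.val.map φ ∈ H}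

end SemiRandom

end

/-! Fix two vertices a, b and four disjoint classes of L vertices, with L of order n. A structure f
picks one vertex x_i from each class; the aim is a clique on a, b, x_0, …, x_3 for some f. Each of
its twenty edges gets its own phase of T rounds. In the sixteen phases for edges that meet {a, b},
the reply is always a or always b, so all L ^ 4 structures are served at once. An edge of three x's
needs a reply that depends on f, which is unambiguous only if no two candidate structures contain
the presented pair.

Let ρ, of order T / n ^ 2, be the probability that a given pair occurs in a phase. Structures
agreeing in j coordinates need the same pair in j ^ 2 of the first sixteen phases. Hence, given that
f survives these phases, the expected number of other survivors sharing two or three coordinates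
with f is at most 6 (L ρ ^ 6) ^ 2 + 4 L ρ ^ 7. For T = n ^ (9 / 5 + η) with small η, ρ has order n ^
(-1 / 5 + η): this expectation vanishes, so most survivors are isolated, while (L ρ ^ 5) ^ 4, the
approximate mean number of isolated survivors that get completed, diverges. The second moment method
(`le_expect_success`) yields a completed one with probability tending to 1.

The game enters through `exists_strategy_value_le` and `expect_le_value`, which reduce it to
independent uniform samples; `containsCopy_of_success` is the combinatorial link. -/

namespace SemiRandom


/-! ### Optimal play and reduction to independent samples -/

section Value

variable {r s n : ℕ}

/-- The expected payoff `G` after `t` further rounds under optimal play from a given history. -/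
noncomputable def value (G : History r s n → ℝ) : ℕ → History r s n → ℝ
  | 0, h => G h
  | t + 1, h => Finset.expect Finset.univ fun U : VertexSet n r =>
      ⨆ V : VertexSet n (s - r), value G t ((U, V) :: h)

theorem value_add (G : History r s n → ℝ) (a b : ℕ) (h : History r s n) :
    value G (a + b) h = value (value G b) a h := by
  induction a generalizing h with
  | zero => simp [value]
  | succ a ih => simp only [Nat.add_right_comm, value, ih]

theorem value_nonneg {G : History r s n → ℝ} (hG : ∀ h, 0 ≤ G h) (t : ℕ) (h : History r s n) :
    0 ≤ value G t h := by
  induction t generalizing h with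
  | zero => exact hG h
  | succ t ih => exact Finset.expect_nonneg fun U _ => Real.iSup_nonneg fun V => ih _

theorem tsum_bind_mul {α β : Type*} (p : PMF α) (f : α → PMF β) (F : β → ENNReal) :
    ∑' b, (p.bind f) b * F b = ∑' a, p a * ∑' b, f a b * F b := by
  simp only [PMF.bind_apply, ← ENNReal.tsum_mul_right, ← ENNReal.tsum_mul_left]
  rw [ENNReal.tsum_comm]
  simp only [mul_assoc]

theorem tsum_pure_mul {α : Type*} (a : α) (F : α → ENNReal) :
    ∑' b, (PMF.pure a) b * F b = F a := by
  rw [tsum_eq_single a fun b hb => by simp [PMF.pure_apply, hb]]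
  simp

theorem length_of_mem_support_historyLaw (hn : r ≤ n) (S : Strategy r s n) (t : ℕ)
    {h : History r s n} (hh : h ∈ (historyLaw hn S t).support) : h.length = t := by
  induction t generalizing h with
  | zero => simp_all [historyLaw]
  | succ t ih =>
    simp only [historyLaw, PMF.mem_support_bind_iff, PMF.mem_support_pure_iff] at hh
    obtain ⟨h', hh', U, -, V, -, rfl⟩ := hh
    simp [ih hh']

theorem ofReal_expect {α : Type*} [Fintype α] [Nonempty α] {f : α → ℝ} (hf : ∀ a, 0 ≤ f a) :
    ENNReal.ofReal (Finset.expect Finset.univ f) =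
      ∑ a, (Fintype.card α : ENNReal)⁻¹ * ENNReal.ofReal (f a) := by
  rw [Fintype.expect_eq_sum_div_card, div_eq_inv_mul, ENNReal.ofReal_mul (by positivity),
    ENNReal.ofReal_inv_of_pos (by exact_mod_cast Fintype.card_pos), ENNReal.ofReal_natCast,
    ENNReal.ofReal_sum_of_nonneg fun a _ => hf a, Finset.mul_sum]

/-- Some strategy achieves the optimal value. -/
theorem exists_strategy_value_le (hn : r ≤ n) (hs : s - r ≤ n) {G : History r s n → ℝ}
    (hG : ∀ h, 0 ≤ G h) (t : ℕ) :
    ∃ S : Strategy r s n, ENNReal.ofReal (value G t []) ≤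
      ∑' h, historyLaw hn S t h * ENNReal.ofReal (G h) := by
  have := VertexSet.nonempty hn
  have := VertexSet.nonempty hs
  -- The number of rounds left after the current reply is `t - h.length - 1`, as the history records
  -- all earlier rounds.
  have hmax : ∀ (h : History r s n) (U : VertexSet n r), ∃ V : VertexSet n (s - r),
      (⨆ W : VertexSet n (s - r), value G (t - h.length - 1) ((U, W) :: h)) =
        value G (t - h.length - 1) ((U, V) :: h) := fun h U =>
    let ⟨V, hV⟩ := exists_eq_ciSup_of_finite
      (f := fun W : VertexSet n (s - r) => value G (t - h.length - 1) ((U, W) :: h))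
    ⟨V, hV.symm⟩
  choose best hbest using hmax
  refine ⟨fun h U => PMF.pure (best h U), ?_⟩
  set S : Strategy r s n := fun h U => PMF.pure (best h U)
  -- Under optimal replies the expected remaining value does not drop from one round to the next.
  -- Histories outside the support, whose length may be wrong, have weight zero.
  have key : ∀ j ≤ t, ENNReal.ofReal (value G t []) ≤
      ∑' h, historyLaw hn S j h * ENNReal.ofReal (value G (t - j) h) := by
    intro j hj
    induction j with
    | zero => simp only [historyLaw]; rw [tsum_pure_mul]; simp
    | succ j ih =>
      refine (ih (by omega)).trans ?_
      simp only [historyLaw]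
      rw [tsum_bind_mul]
      refine ENNReal.tsum_le_tsum fun h => ?_
      by_cases hh : h ∈ (historyLaw hn S j).support
      · gcongr
        have hl := length_of_mem_support_historyLaw hn S j hh
        obtain ⟨d, hd⟩ : ∃ d, t - j = d + 1 := ⟨t - j - 1, by omega⟩
        have hd' : t - (j + 1) = d := by omega
        have hd'' : t - h.length - 1 = d := by omega
        rw [hd, hd', value, ofReal_expect fun U => Real.iSup_nonneg fun V => value_nonneg hG _ _]
        simp only [tsum_bind_mul, S, tsum_pure_mul]
        rw [tsum_fintype]
        refine le_of_eq (Finset.sum_congr rfl fun U _ => ?_)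
        have := hbest h U
        rw [hd''] at this
        rw [this]
        simp [uniformVertexSet, PMF.uniformOfFintype_apply]
      · rw [PMF.mem_support_iff, not_not] at hh
        simp [hh]
  simpa [value] using key t le_rfl

theorem expect_fin_succ {α : Type*} [Fintype α] [Nonempty α] (N : ℕ) (F : (Fin (N + 1) → α) → ℝ) :
    Finset.expect Finset.univ F = Finset.expect Finset.univ fun a : α =>
      Finset.expect Finset.univ fun ω : Fin N → α => F (Fin.cons a ω) := by
  simp only [Fintype.expect_eq_sum_div_card, ← Finset.sum_div, div_div]
  congr 1
  · rw [← (Fin.consEquiv fun _ => α).sum_comp, Fintype.sum_prod_type]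
    rfl
  · simp [pow_succ]

/-- The value is at least the expected payoff when the answer in round `i` is a function `D i` of the
pair presented in that round. -/
theorem expect_le_value_fin [Nonempty (VertexSet n r)] (N : ℕ)
    (D : Fin N → VertexSet n r → VertexSet n (s - r)) (G : History r s n → ℝ)
    (h : History r s n) (F : (Fin N → VertexSet n r) → ℝ)
    (hF : ∀ ω h', h ⊆ h' → (∀ i, (ω i, D i (ω i)) ∈ h') → F ω ≤ G h') :
    Finset.expect Finset.univ F ≤ value G N h := by
  induction N generalizing h with
  | zero =>
    rw [Fintype.expect_eq_sum_div_card]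
    simpa [value] using hF default h (List.Subset.refl _) (fun i => i.elim0)
  | succ N ih =>
    rw [expect_fin_succ, value]
    refine Finset.expect_le_expect fun U _ => ?_
    refine le_trans ?_ (le_ciSup (Set.finite_range _).bddAbove (D 0 U))
    refine ih (fun i => D i.succ) _ _ fun ω h' hh hω => hF _ _ ?_ ?_
    · exact fun x hx => hh (List.mem_cons_of_mem _ hx)
    · intro i
      refine Fin.cases ?_ (fun i => ?_) i
      · exact hh (by simp)
      · simpa using hω i

/-- The hypothesis on `G` mentions only membership of moves in the history, so the order of the
rounds is immaterial and any finite index type may label them. -/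
theorem expect_le_value [Nonempty (VertexSet n r)] {I : Type*} [Fintype I] [DecidableEq I]
    (D : I → VertexSet n r → VertexSet n (s - r)) (G : History r s n → ℝ)
    (h : History r s n) (F : (I → VertexSet n r) → ℝ)
    (hF : ∀ ω h', h ⊆ h' → (∀ i, (ω i, D i (ω i)) ∈ h') → F ω ≤ G h') :
    Finset.expect Finset.univ F ≤ value G (Fintype.card I) h := by
  let e := Fintype.equivFin I
  rw [Fintype.expect_equiv (e.arrowCongr (Equiv.refl (VertexSet n r))) F
    (fun ω => F (ω ∘ e)) fun ω => by congr 1; ext; simp]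
  refine expect_le_value_fin _ (fun i => D (e.symm i)) G h _ fun ω h' hh hω => hF _ _ hh ?_
  intro i
  simpa using hω (e i)

end Value

/-! ### Occurrence of given pairs in a uniform sample -/

section Hitting

theorem expect_pi_prod {K : Type*} [Fintype K] [DecidableEq K] {Ω : Type*} [Fintype Ω]
    (g : K → Ω → ℝ) :
    (Finset.expect Finset.univ fun ω : K → Ω => ∏ k, g k (ω k)) =
      ∏ k, Finset.expect Finset.univ (g k) := by
  simp only [Fintype.expect_eq_sum_div_card, Finset.prod_div_distrib]
  rw [Finset.prod_univ_sum, Fintype.piFinset_univ]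
  simp

/-- The probability that a given element is among `T` uniform samples out of `M`. -/
noncomputable def hitProb (M T : ℕ) : ℝ := 1 - (1 - 1 / (M : ℝ)) ^ T

open Classical in
/-- The indicator of `x` being a value of `ω`. -/
noncomputable def hit {P : Type*} {T : ℕ} (ω : Fin T → P) (x : P) : ℝ :=
  if ∃ i, ω i = x then 1 else 0

variable {P : Type*} {T : ℕ}

theorem hit_nonneg (ω : Fin T → P) (x : P) : 0 ≤ hit ω x := by
  unfold hit; split_ifs <;> norm_num

theorem hit_le_one (ω : Fin T → P) (x : P) : hit ω x ≤ 1 := by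
  unfold hit; split_ifs <;> norm_num

theorem hit_mul_self (ω : Fin T → P) (x : P) : hit ω x * hit ω x = hit ω x := by
  unfold hit; split_ifs <;> norm_num

open Classical in
theorem hit_eq (ω : Fin T → P) (x : P) :
    hit ω x = 1 - ∏ i, (if ω i = x then 0 else 1 : ℝ) := by
  unfold hit
  split_ifs with h
  · obtain ⟨i, hi⟩ := h
    rw [Finset.prod_eq_zero (Finset.mem_univ i) (by simp [hi])]; simp
  · push Not at h
    simp [h]

variable [Fintype P] [Nonempty P]

theorem expect_hit (x : P) :
    (Finset.expect Finset.univ fun ω : Fin T → P => hit ω x) =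
      hitProb (Fintype.card P) T := by
  classical
  have hM : (Fintype.card P : ℝ) ≠ 0 := by exact_mod_cast Fintype.card_ne_zero
  simp only [hit_eq, Finset.expect_sub_distrib]
  rw [expect_pi_prod fun _ y => if y = x then 0 else 1]
  rw [Fintype.expect_const]
  simp only [Fintype.expect_eq_sum_div_card, Finset.prod_const, Finset.card_univ, Fintype.card_fin,
    hitProb]
  congr 2
  have : ∀ y : P, (if y = x then 0 else 1 : ℝ) = 1 - if y = x then 1 else 0 := by
    intro y; split_ifs <;> norm_num
  simp only [this, Finset.sum_sub_distrib]
  simp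
  field_simp

/-- Occurrences of distinct elements are negatively correlated: by inclusion–exclusion the claim
reduces to (1 - 2 / M) ^ T ≤ (1 - 1 / M) ^ (2 T). -/
theorem expect_hit_mul_hit_le {x y : P} (hxy : x ≠ y) :
    (Finset.expect Finset.univ fun ω : Fin T → P => hit ω x * hit ω y) ≤
      hitProb (Fintype.card P) T ^ 2 := by
  classical
  have hc : 2 ≤ Fintype.card P := by
    rw [← Finset.card_pair hxy]; exact Finset.card_le_univ _
  have hM : (2 : ℝ) ≤ Fintype.card P := by exact_mod_cast hc
  have e : ∀ ω : Fin T → P, hit ω x * hit ω y = hit ω x + hit ω y - 1 +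
      ∏ i, (if ω i = x then 0 else 1) * (if ω i = y then 0 else 1 : ℝ) := by
    intro ω
    rw [hit_eq, hit_eq, Finset.prod_mul_distrib]; ring
  simp only [e, Finset.expect_sub_distrib, Finset.expect_add_distrib, expect_hit]
  rw [expect_pi_prod fun _ z => (if z = x then 0 else 1) * (if z = y then 0 else 1), Fintype.expect_const]
  simp only [Fintype.expect_eq_sum_div_card, Finset.prod_const, Finset.card_univ, Fintype.card_fin]
  have : ∀ z : P, (if z = x then 0 else 1) * (if z = y then 0 else 1 : ℝ) =
      1 - (if z = x then 1 else 0) - if z = y then 1 else 0 := by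
    intro z
    by_cases h1 : z = x
    · simp [h1, hxy]
    · by_cases h2 : z = y <;> simp [h1, h2, hxy.symm]
  simp only [this, Finset.sum_sub_distrib]
  simp only [Finset.sum_const, Finset.card_univ, nsmul_eq_mul, mul_one, Finset.sum_ite_eq',
    Finset.mem_univ, if_true]
  set M : ℝ := (Fintype.card P : ℝ)
  have h1 : ((M - 1 - 1) / M) ^ T ≤ ((1 - 1 / M) ^ T) ^ 2 := by
    rw [← pow_mul, mul_comm T 2, pow_mul]
    apply pow_le_pow_left₀ (div_nonneg (by linarith) (by linarith))
    have : (M - 1 - 1) / M = 1 - 2 * (1 / M) := by field_simp; ring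
    rw [this]
    nlinarith [sq_nonneg (1 / M)]
  unfold hitProb
  change _ + (1 - (1 - 1 / M) ^ T) - 1 + _ ≤ (1 - (1 - 1 / M) ^ T) ^ 2
  change (1 - (1 - 1 / M) ^ T) + (1 - (1 - 1 / M) ^ T) - 1 + _ ≤ (1 - (1 - 1 / M) ^ T) ^ 2
  nlinarith [h1]

theorem hitProb_le {M : ℕ} (hM : 1 ≤ M) (T : ℕ) : hitProb M T ≤ T / M := by
  have h1 : (1 : ℝ) ≤ M := by exact_mod_cast hM
  have := one_add_mul_le_pow (a := -(1 / (M : ℝ)))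
    (by have : 1 / (M : ℝ) ≤ 1 := by rw [div_le_one (by linarith)]; exact h1
        linarith) T
  unfold hitProb
  rw [← sub_eq_add_neg] at this
  have e : (T : ℝ) / M = T * (1 / M) := by ring
  rw [e]; linarith

theorem le_hitProb {M T : ℕ} (hM : 1 ≤ M) (hT : T ≤ M) : (T : ℝ) / M / 2 ≤ hitProb M T := by
  have h1 : (1 : ℝ) ≤ M := by exact_mod_cast hM
  have hx : (T : ℝ) / M ≤ 1 := by rw [div_le_one (by linarith)]; exact_mod_cast hT
  have hx0 : 0 ≤ (T : ℝ) / M := by positivity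
  have h2 : (1 - 1 / (M : ℝ)) ^ T ≤ Real.exp (-(T / M)) := by
    have := pow_le_pow_left₀ (by
      have : 1 / (M : ℝ) ≤ 1 := by rw [div_le_one (by linarith)]; exact h1
      linarith) (Real.one_sub_le_exp_neg (1 / (M : ℝ))) T
    refine this.trans (le_of_eq ?_)
    rw [← Real.exp_nat_mul]; congr 1; ring
  -- With x = T / M in [0, 1], this is exp (-x) ≤ 1 / (1 + x) ≤ 1 - x / 2.
  have h3 : Real.exp (-((T : ℝ) / M)) ≤ 1 - (T : ℝ) / M / 2 := by
    rw [Real.exp_neg, inv_le_comm₀ (Real.exp_pos _) (by linarith)]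
    refine le_trans ?_ (Real.add_one_le_exp _)
    rw [inv_le_iff_one_le_mul₀ (by linarith)]
    nlinarith
  unfold hitProb
  linarith

theorem hitProb_nonneg {M : ℕ} (hM : 1 ≤ M) (T : ℕ) : 0 ≤ hitProb M T := by
  have h1 : (1 : ℝ) ≤ M := by exact_mod_cast hM
  have h2 : 1 / (M : ℝ) ≤ 1 := by rw [div_le_one (by linarith)]; exact h1
  have h3 : 0 ≤ 1 / (M : ℝ) := by positivity
  have := pow_le_one₀ (n := T) (by linarith : 0 ≤ 1 - 1 / (M : ℝ)) (by linarith)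
  unfold hitProb
  linarith

theorem hitProb_le_one {M : ℕ} (hM : 1 ≤ M) (T : ℕ) : hitProb M T ≤ 1 := by
  have h1 : (1 : ℝ) ≤ M := by exact_mod_cast hM
  have h2 : 1 / (M : ℝ) ≤ 1 := by rw [div_le_one (by linarith)]; exact h1
  have := pow_nonneg (by linarith : 0 ≤ 1 - 1 / (M : ℝ)) T
  unfold hitProb
  linarith

end Hitting

/-! ### Survivors, agreement of structures, isolation -/

section SecondMoment

variable {K P ι : Type*} {T : ℕ}

/-- The indicator that for every phase `k` the sample `ω k` contains the pair `e k f` needed by the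
structure `f`. -/
noncomputable def survive [Fintype K] (e : K → ι → P) (ω : K → Fin T → P) (f : ι) : ℝ :=
  ∏ k, hit (ω k) (e k f)

theorem survive_nonneg [Fintype K] (e : K → ι → P) (ω : K → Fin T → P) (f : ι) :
    0 ≤ survive e ω f :=
  Finset.prod_nonneg fun _ _ => hit_nonneg _ _

theorem survive_le_one [Fintype K] (e : K → ι → P) (ω : K → Fin T → P) (f : ι) :
    survive e ω f ≤ 1 :=
  Finset.prod_le_one (fun _ _ => hit_nonneg _ _) fun _ _ => hit_le_one _ _

theorem survive_mul_self [Fintype K] (e : K → ι → P) (ω : K → Fin T → P) (f : ι) :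
    survive e ω f * survive e ω f = survive e ω f := by
  simp only [survive, ← Finset.prod_mul_distrib, hit_mul_self]

theorem exists_eq_of_survive_ne_zero [Fintype K] {e : K → ι → P} {ω : K → Fin T → P} {f : ι}
    (h : survive e ω f ≠ 0) (k : K) : ∃ t, ω k t = e k f := by
  have := Finset.prod_ne_zero_iff.1 h k (Finset.mem_univ k)
  by_contra hne
  exact this (by simp [hit, hne])

variable {L : ℕ}

/-- The coordinates on which two structures agree. -/
def agree (f g : Fin 4 → Fin L) : Finset (Fin 4) := Finset.univ.filter fun i => f i = g i

theorem mem_agree {f g : Fin 4 → Fin L} {i : Fin 4} : i ∈ agree f g ↔ f i = g i := by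
  simp [agree]

theorem agree_card_le (f g : Fin 4 → Fin L) : (agree f g).card ≤ 4 :=
  (Finset.card_le_univ _).trans (by simp)

theorem agree_card_eq_four {f g : Fin 4 → Fin L} (h : (agree f g).card = 4) : f = g := by
  have : agree f g = Finset.univ := Finset.eq_univ_of_card _ (by simpa using h)
  exact funext fun i => mem_agree.1 (by simp [this])

theorem card_filter_agree_le (f : Fin 4 → Fin L) (S : Finset (Fin 4)) :
    (Finset.univ.filter fun g => agree f g = S).card ≤ L ^ (4 - S.card) := by
  have h : (Finset.univ.filter fun g => agree f g = S) ⊆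
      Fintype.piFinset fun i => if i ∈ S then {f i} else Finset.univ := by
    intro g hg
    simp only [Finset.mem_filter, Finset.mem_univ, true_and] at hg
    rw [Fintype.mem_piFinset]
    intro i
    split_ifs with hi
    · rw [← hg, mem_agree] at hi
      simp [hi]
    · simp
  refine (Finset.card_le_card h).trans (le_of_eq ?_)
  rw [Fintype.card_piFinset]
  have : ∀ i, (if i ∈ S then {f i} else (Finset.univ : Finset (Fin L))).card =
      if i ∈ S then 1 else L := fun i => by split_ifs <;> simp
  simp only [this]
  rw [Finset.prod_ite, Finset.prod_const_one, one_mul, Finset.prod_const]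
  congr 1
  have : (Finset.univ.filter fun i => i ∉ S) = Sᶜ := by ext; simp
  rw [this, Finset.card_compl, Fintype.card_fin]

/-- Group the structures by their agreement set S with f: at most L ^ (4 - |S|) have a given S, and
the binomial coefficients count the sets S. -/
theorem sum_agree_le (f : Fin 4 → Fin L) (c : ℕ → ℝ) (hc : ∀ j, 0 ≤ c j) :
    ∑ g, c (agree f g).card ≤
      L ^ 4 * c 0 + 4 * L ^ 3 * c 1 + 6 * L ^ 2 * c 2 + 4 * L * c 3 + c 4 := by
  have h1 : ∑ g, c (agree f g).card =
      ∑ S : Finset (Fin 4), ∑ g ∈ Finset.univ.filter (fun g => agree f g = S),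
        c (agree f g).card :=
    (Finset.sum_fiberwise _ (agree f) _).symm
  have h2 : ∑ g, c (agree f g).card ≤
      ∑ S ∈ (Finset.univ : Finset (Fin 4)).powerset, (L : ℝ) ^ (4 - S.card) * c S.card := by
    rw [h1, Finset.powerset_univ]
    refine Finset.sum_le_sum fun S _ => ?_
    rw [Finset.sum_congr rfl (g := fun _ => c S.card)
      fun g hg => by rw [(Finset.mem_filter.1 hg).2], Finset.sum_const, nsmul_eq_mul]
    exact mul_le_mul_of_nonneg_right (by exact_mod_cast card_filter_agree_le f S) (hc _)
  refine h2.trans (le_of_eq ?_)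
  rw [Finset.sum_powerset_apply_card (fun j => (L : ℝ) ^ (4 - j) * c j)]
  simp [Finset.sum_range_succ, Nat.choose]
  ring

variable [Fintype K]

/-- A structure that survives and shares at most one coordinate with every other survivor. -/
def IsIsolated (e : K → (Fin 4 → Fin L) → P) (ω : K → Fin T → P) (f : Fin 4 → Fin L) : Prop :=
  survive e ω f ≠ 0 ∧ ∀ g, g ≠ f → survive e ω g ≠ 0 → (agree f g).card ≤ 1

open Classical in
/-- The indicator of `IsIsolated`. -/
noncomputable def isolated (e : K → (Fin 4 → Fin L) → P) (ω : K → Fin T → P)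
    (f : Fin 4 → Fin L) : ℝ :=
  if IsIsolated e ω f then 1 else 0

theorem isolated_nonneg (e : K → (Fin 4 → Fin L) → P) (ω : K → Fin T → P)
    (f : Fin 4 → Fin L) : 0 ≤ isolated e ω f := by
  unfold isolated; split_ifs <;> norm_num

theorem survive_eq_zero_or_one (e : K → ι → P) (ω : K → Fin T → P) (f : ι) :
    survive e ω f = 0 ∨ survive e ω f = 1 := by
  have := survive_mul_self e ω f
  by_cases h : survive e ω f = 0
  · exact Or.inl h
  · exact Or.inr (mul_left_cancel₀ h (by rw [this, mul_one]))

theorem isolated_le_survive (e : K → (Fin 4 → Fin L) → P) (ω : K → Fin T → P)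
    (f : Fin 4 → Fin L) : isolated e ω f ≤ survive e ω f := by
  unfold isolated
  split_ifs with h
  · rcases survive_eq_zero_or_one e ω f with h' | h'
    · exact absurd h' h.1
    · exact h'.ge
  · exact survive_nonneg _ _ _

theorem isolated_mul_eq_zero (e : K → (Fin 4 → Fin L) → P) (ω : K → Fin T → P)
    {f g : Fin 4 → Fin L} (hfg : g ≠ f) (h : 2 ≤ (agree f g).card) :
    isolated e ω f * isolated e ω g = 0 := by
  unfold isolated
  split_ifs with h1 h2
  · have := h1.2 g hfg h2.1
    omega
  all_goals simp

/-- A union bound: a survivor that is not isolated has a surviving rival that contributes 1 to the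
sum. Agreement in all four coordinates is left out since the rival differs from f. -/
theorem le_isolated (e : K → (Fin 4 → Fin L) → P) (ω : K → Fin T → P) (f : Fin 4 → Fin L) :
    survive e ω f - (∑ g, if 2 ≤ (agree f g).card ∧ (agree f g).card ≤ 3 then
      survive e ω f * survive e ω g else 0) ≤ isolated e ω f := by
  classical
  have hnn : ∀ g, 0 ≤ if 2 ≤ (agree f g).card ∧ (agree f g).card ≤ 3 then
      survive e ω f * survive e ω g else 0 := fun g => by
    split_ifs
    · exact mul_nonneg (survive_nonneg _ _ _) (survive_nonneg _ _ _)
    · exact le_rfl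
  unfold isolated
  split_ifs with h
  · have := Finset.sum_nonneg fun g (_ : g ∈ Finset.univ) => hnn g
    linarith [survive_le_one e ω f]
  · rcases survive_eq_zero_or_one e ω f with h0 | h0
    · have := Finset.sum_nonneg fun g (_ : g ∈ Finset.univ) => hnn g
      linarith
    · have : ∃ g, g ≠ f ∧ survive e ω g ≠ 0 ∧ 2 ≤ (agree f g).card := by
        by_contra hne
        push Not at hne
        exact h ⟨by simp [h0], fun g hg hs => Nat.lt_succ_iff.1 (hne g hg hs)⟩
      obtain ⟨g, hg, hs, hc⟩ := this
      have h4 : (agree f g).card ≤ 3 := by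
        have := agree_card_le f g
        have : (agree f g).card ≠ 4 := fun h => hg (agree_card_eq_four h).symm
        omega
      have := Finset.single_le_sum (fun g (_ : g ∈ Finset.univ) => hnn g) (Finset.mem_univ g)
      rw [if_pos ⟨hc, h4⟩, (survive_eq_zero_or_one e ω g).resolve_left hs] at this
      linarith

variable [Fintype P] [Nonempty P] [DecidableEq K]

theorem expect_survive (e : K → ι → P) (f : ι) :
    (Finset.expect Finset.univ fun ω : K → Fin T → P => survive e ω f) =
      hitProb (Fintype.card P) T ^ Fintype.card K := by
  simp only [survive]
  rw [expect_pi_prod fun k (x : Fin T → P) => hit x (e k f)]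
  simp [expect_hit]

-- Phases are independent. A phase where both structures need the same pair costs one factor ρ; any
-- other costs at most ρ ^ 2 by negative correlation.
open Classical in
theorem expect_survive_mul_le (e : K → ι → P) (f g : ι) :
    (Finset.expect Finset.univ fun ω : K → Fin T → P => survive e ω f * survive e ω g) ≤
      hitProb (Fintype.card P) T ^
        (2 * Fintype.card K - (Finset.univ.filter fun k => e k f = e k g).card) := by
  simp only [survive, ← Finset.prod_mul_distrib]
  rw [expect_pi_prod fun k (x : Fin T → P) => hit x (e k f) * hit x (e k g)]
  have hρ : 0 ≤ hitProb (Fintype.card P) T := hitProb_nonneg Fintype.card_pos T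
  calc _ ≤ ∏ k, (if e k f = e k g then hitProb (Fintype.card P) T
        else hitProb (Fintype.card P) T ^ 2) := by
        refine Finset.prod_le_prod (fun k _ => Finset.expect_nonneg fun x _ =>
          mul_nonneg (hit_nonneg _ _) (hit_nonneg _ _)) fun k _ => ?_
        split_ifs with h
        · simp only [h, hit_mul_self, expect_hit, le_refl]
        · exact expect_hit_mul_hit_le h
    _ = _ := by
        rw [Finset.prod_ite, Finset.prod_const, Finset.prod_const, ← pow_mul, ← pow_add]
        congr 1
        have := Finset.card_filter_add_card_filter_not (s := (Finset.univ : Finset K))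
          (fun k => e k f = e k g)
        rw [Finset.card_univ] at this
        omega

end SecondMoment

/-! ### Second moment bound for completed isolated survivors -/

section Success

variable {P : Type*} {T L : ℕ}

/-- An isolated survivor of the sixteen phases of `e` survives the four phases of `e'` too. -/
def Success (e : Fin 4 × Fin 4 → (Fin 4 → Fin L) → P) (e' : Fin 4 → (Fin 4 → Fin L) → P)
    (ω : Fin 4 × Fin 4 → Fin T → P) (ω' : Fin 4 → Fin T → P) : Prop :=
  ∃ f, IsIsolated e ω f ∧ survive e' ω' f ≠ 0

/-- The shared phases are exactly the square of the agreement set; indexing phases by ordered pairs,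
diagonal included, makes this count a perfect square. -/
theorem card_filter_prod_agree {e : Fin 4 × Fin 4 → (Fin 4 → Fin L) → P}
    [DecidableEq P]
    (he : ∀ i j f g, e (i, j) f = e (i, j) g ↔ f i = g i ∧ f j = g j) (f g : Fin 4 → Fin L) :
    (Finset.univ.filter fun k => e k f = e k g).card = (agree f g).card ^ 2 := by
  rw [sq, ← Finset.card_product]
  congr 1
  ext ⟨i, j⟩
  simp [he, mem_agree]

variable [Fintype P] [Nonempty P]

theorem expect_survive_prod_le {e : Fin 4 × Fin 4 → (Fin 4 → Fin L) → P}
    (he : ∀ i j f g, e (i, j) f = e (i, j) g ↔ f i = g i ∧ f j = g j) (f g : Fin 4 → Fin L) :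
    (Finset.expect Finset.univ fun ω : Fin 4 × Fin 4 → Fin T → P =>
      survive e ω f * survive e ω g) ≤
      hitProb (Fintype.card P) T ^ (32 - (agree f g).card ^ 2) := by
  classical
  have := expect_survive_mul_le (T := T) e f g
  rw [card_filter_prod_agree he] at this
  simpa using this

theorem le_expect_isolated {e : Fin 4 × Fin 4 → (Fin 4 → Fin L) → P}
    (he : ∀ i j f g, e (i, j) f = e (i, j) g ↔ f i = g i ∧ f j = g j) (f : Fin 4 → Fin L) :
    hitProb (Fintype.card P) T ^ 16 - (6 * L ^ 2 * hitProb (Fintype.card P) T ^ 28 +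
      4 * L * hitProb (Fintype.card P) T ^ 23) ≤
    Finset.expect Finset.univ fun ω : Fin 4 × Fin 4 → Fin T → P => isolated e ω f := by
  have hρ : 0 ≤ hitProb (Fintype.card P) T := hitProb_nonneg Fintype.card_pos T
  set ρ := hitProb (Fintype.card P) T
  have h1 := Finset.expect_le_expect (s := Finset.univ)
    fun (ω : Fin 4 × Fin 4 → Fin T → P) _ => le_isolated e ω f
  refine le_trans ?_ h1
  rw [Finset.expect_sub_distrib, expect_survive, Finset.expect_sum_comm]
  have h2 : ∀ g, (Finset.expect Finset.univ fun ω : Fin 4 × Fin 4 → Fin T → P =>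
      if 2 ≤ (agree f g).card ∧ (agree f g).card ≤ 3 then
      survive e ω f * survive e ω g else 0) ≤
      (fun j => if 2 ≤ j ∧ j ≤ 3 then ρ ^ (32 - j ^ 2) else 0) (agree f g).card := by
    intro g
    dsimp only
    split_ifs
    · exact expect_survive_prod_le he f g
    · simp
  have h3 := (Finset.sum_le_sum fun g (_ : g ∈ Finset.univ) => h2 g).trans
    (sum_agree_le f (fun j => if 2 ≤ j ∧ j ≤ 3 then ρ ^ (32 - j ^ 2) else 0) fun j => by
      split_ifs <;> positivity)
  norm_num at h3
  have h4 : Fintype.card (Fin 4 × Fin 4) = 16 := by simp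
  rw [h4]
  linarith

/-- With at most one common coordinate no completion pair is shared, which gives the extra ρ ^ 8.
With four the structures coincide. With two or three they cannot both be isolated, so the large
correlations disappear. -/
theorem expect_isolated_mul_survive_le {e : Fin 4 × Fin 4 → (Fin 4 → Fin L) → P}
    {e' : Fin 4 → (Fin 4 → Fin L) → P}
    (he : ∀ i j f g, e (i, j) f = e (i, j) g ↔ f i = g i ∧ f j = g j)
    (he' : ∀ l f g, e' l f = e' l g → 2 ≤ (agree f g).card) (f g : Fin 4 → Fin L) :
    (Finset.expect Finset.univ fun ω : Fin 4 × Fin 4 → Fin T → P =>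
        isolated e ω f * isolated e ω g) *
      (Finset.expect Finset.univ fun ω : Fin 4 → Fin T → P => survive e' ω f * survive e' ω g) ≤
      (fun j => if j ≤ 1 then hitProb (Fintype.card P) T ^ (32 - j ^ 2 + 8) else
        if j = 4 then hitProb (Fintype.card P) T ^ 20 else 0) (agree f g).card := by
  classical
  have hρ : 0 ≤ hitProb (Fintype.card P) T := hitProb_nonneg Fintype.card_pos T
  have h1 : (Finset.expect Finset.univ fun ω : Fin 4 × Fin 4 → Fin T → P =>
        isolated e ω f * isolated e ω g) ≤
      hitProb (Fintype.card P) T ^ (32 - (agree f g).card ^ 2) :=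
    (Finset.expect_le_expect fun ω _ => mul_le_mul (isolated_le_survive e ω f)
      (isolated_le_survive e ω g) (isolated_nonneg _ _ _) (survive_nonneg _ _ _)).trans
      (expect_survive_prod_le he f g)
  have h0 : 0 ≤ Finset.expect Finset.univ fun ω : Fin 4 → Fin T → P =>
      survive e' ω f * survive e' ω g :=
    Finset.expect_nonneg fun ω _ => mul_nonneg (survive_nonneg _ _ _) (survive_nonneg _ _ _)
  dsimp only
  split_ifs with ha hb
  · rw [pow_add]
    refine mul_le_mul h1 ?_ h0 (by positivity)
    refine (expect_survive_mul_le e' f g).trans (le_of_eq ?_)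
    have : (Finset.univ.filter fun k => e' k f = e' k g) = ∅ :=
      Finset.filter_false_of_mem fun k _ hk => by have := he' k f g hk; omega
    rw [this]; simp
  · obtain rfl := agree_card_eq_four hb
    rw [hb] at h1
    calc _ ≤ hitProb (Fintype.card P) T ^ (32 - 4 ^ 2) * hitProb (Fintype.card P) T ^ 4 := by
          refine mul_le_mul h1 ?_ h0 (by positivity)
          simp only [survive_mul_self, expect_survive]
          simp
      _ = _ := by rw [← pow_add]; norm_num
  · have hne : g ≠ f := by
      rintro rfl
      have : agree g g = Finset.univ := by ext; simp [mem_agree]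
      rw [this] at hb
      simp at hb
    simp [isolated_mul_eq_zero e _ hne (by omega)]

open Classical in
/-- The second moment bound for the probability of success. -/
theorem le_expect_success {e : Fin 4 × Fin 4 → (Fin 4 → Fin L) → P}
    {e' : Fin 4 → (Fin 4 → Fin L) → P}
    (he : ∀ i j f g, e (i, j) f = e (i, j) g ↔ f i = g i ∧ f j = g j)
    (he' : ∀ l f g, e' l f = e' l g → 2 ≤ (agree f g).card)
    (hL : 0 < L) (hρ : 0 < hitProb (Fintype.card P) T) :
    1 - (12 * (L * hitProb (Fintype.card P) T ^ 6) ^ 2 +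
        8 * (L * hitProb (Fintype.card P) T ^ 7) +
        4 * (L * hitProb (Fintype.card P) T)⁻¹ + ((L * hitProb (Fintype.card P) T ^ 5) ^ 4)⁻¹) ≤
      Finset.expect Finset.univ fun ω : Fin 4 × Fin 4 → Fin T → P =>
        Finset.expect Finset.univ fun ω' : Fin 4 → Fin T → P =>
          if Success e e' ω ω' then (1 : ℝ) else 0 := by
  set ρ := hitProb (Fintype.card P) T with hρdef
  have hL' : (0 : ℝ) < L := by exact_mod_cast hL
  set m : ℝ := L ^ 4 * ρ ^ 20 with hm
  have hm0 : 0 < m := by positivity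
  set X : (Fin 4 × Fin 4 → Fin T → P) → (Fin 4 → Fin T → P) → ℝ :=
    fun ω ω' => ∑ f, isolated e ω f * survive e' ω' f with hX
  -- The left side is 1 - (1 - X / m) ^ 2, which is at most 1 and vanishes at X = 0. Thus a lower
  -- bound on the mean and an upper bound on the second moment suffice, and `m` need not be the
  -- exact mean.
  have hpt : ∀ ω ω', 2 / m * X ω ω' - 1 / m ^ 2 * (X ω ω' * X ω ω') ≤
      if Success e e' ω ω' then (1 : ℝ) else 0 := by
    intro ω ω'
    split_ifs with h
    · have h1 : 2 / m * X ω ω' - 1 / m ^ 2 * (X ω ω' * X ω ω') = 1 - (1 - X ω ω' / m) ^ 2 := by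
        field_simp; ring
      rw [h1]; linarith [sq_nonneg (1 - X ω ω' / m)]
    · have : X ω ω' = 0 := by
        refine Finset.sum_eq_zero fun f _ => ?_
        by_contra hne
        have h1 := left_ne_zero_of_mul hne
        refine h ⟨f, ?_, right_ne_zero_of_mul hne⟩
        by_contra h2
        exact h1 (by simp [isolated, h2])
      simp [this]
  refine le_trans ?_ (Finset.expect_le_expect fun ω _ => Finset.expect_le_expect
    fun ω' _ => hpt ω ω')
  simp only [Finset.expect_sub_distrib, ← Finset.mul_expect]
  have hE1 : (L : ℝ) ^ 4 * ((ρ ^ 16 - (6 * L ^ 2 * ρ ^ 28 + 4 * L * ρ ^ 23)) * ρ ^ 4) ≤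
      Finset.expect Finset.univ fun ω => Finset.expect Finset.univ fun ω' => X ω ω' := by
    simp only [hX, Finset.expect_sum_comm, ← Finset.mul_expect, expect_survive,
      ← Finset.expect_mul]
    calc _ = ∑ f : Fin 4 → Fin L, (ρ ^ 16 - (6 * L ^ 2 * ρ ^ 28 + 4 * L * ρ ^ 23)) * ρ ^ 4 := by
          simp
      _ ≤ _ := by
          refine Finset.sum_le_sum fun f _ => ?_
          rw [Fintype.card_fin]
          exact mul_le_mul_of_nonneg_right (le_expect_isolated he f) (by positivity)
  have hE2 : (Finset.expect Finset.univ fun ω => Finset.expect Finset.univ fun ω' =>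
      X ω ω' * X ω ω') ≤ L ^ 4 * (L ^ 4 * ρ ^ 40 + 4 * L ^ 3 * ρ ^ 39 + ρ ^ 20) := by
    have hXX : ∀ ω ω', X ω ω' * X ω ω' = ∑ f, ∑ g, (isolated e ω f * isolated e ω g) *
        (survive e' ω' f * survive e' ω' g) := by
      intro ω ω'
      simp only [hX, Finset.sum_mul_sum]
      refine Finset.sum_congr rfl fun f _ => Finset.sum_congr rfl fun g _ => by ring
    simp only [hXX, Finset.expect_sum_comm, ← Finset.mul_expect, ← Finset.expect_mul]
    calc _ ≤ ∑ f : Fin 4 → Fin L, (L ^ 4 * ρ ^ 40 + 4 * L ^ 3 * ρ ^ 39 + ρ ^ 20) := by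
          refine Finset.sum_le_sum fun f _ => ?_
          refine (Finset.sum_le_sum fun g _ =>
            expect_isolated_mul_survive_le he he' f g).trans ?_
          refine (sum_agree_le f (fun j => if j ≤ 1 then ρ ^ (32 - j ^ 2 + 8) else
            if j = 4 then ρ ^ 20 else 0) fun j => by split_ifs <;> positivity).trans ?_
          norm_num
      _ = _ := by simp; ring
  have h1 := mul_le_mul_of_nonneg_left hE1 (by positivity : 0 ≤ 2 / m)
  have h2 := mul_le_mul_of_nonneg_left hE2 (by positivity : 0 ≤ 1 / m ^ 2)
  refine le_trans (le_of_eq ?_) (sub_le_sub h1 h2)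
  rw [hm]
  field_simp
  ring

end Success

/-! ### The strategy and the clique it builds -/

section Game

variable {n L T : ℕ}

theorem toOuterMeasure_graphLaw {r s n : ℕ} (hn : r ≤ n) (S : Strategy r s n) (t : ℕ)
    (A : Set (MultiHypergraph (Fin n))) :
    (graphLaw hn S t).toOuterMeasure A = ∑' h, historyLaw hn S t h *
      ENNReal.ofReal (Set.indicator (History.graph ⁻¹' A) 1 h) := by
  rw [graphLaw, PMF.toOuterMeasure_map_apply, PMF.toOuterMeasure_apply]
  refine tsum_congr fun h => ?_
  by_cases hh : h ∈ History.graph ⁻¹' A <;> simp [hh]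

/-- The `2`-set `{a, b}`. -/
def vertexPair {a b : Fin n} (h : a ≠ b) : VertexSet n 2 := ⟨{a, b}, Finset.card_pair h⟩

/-- The `1`-set `{a}`. -/
def vertexSingle (a : Fin n) : VertexSet n (3 - 2) := ⟨{a}, Finset.card_singleton a⟩

theorem mem_graph_of_mem {h : History 2 3 n} {a b : Fin n} (hab : a ≠ b) {c : Fin n}
    (hm : (vertexPair hab, vertexSingle c) ∈ h) : ({a, b, c} : Multiset (Fin n)) ∈ h.graph := by
  have : ({a, b, c} : Multiset (Fin n)) =
      (vertexPair hab).1.val + (vertexSingle c).1.val := by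
    simp only [vertexPair, vertexSingle]
    rw [Finset.insert_val_of_notMem (by simpa using hab)]
    rfl
  rw [this]
  simp only [History.graph, Multiset.mem_coe, List.mem_map]
  exact ⟨_, hm, rfl⟩

/-- The pair that must be presented in phase `(i, j)` for the structure `f`. -/
def firstPair (ψ : Fin 2 ⊕ Fin 4 × Fin L ↪ Fin n) (k : Fin 4 × Fin 4) (f : Fin 4 → Fin L) :
    VertexSet n 2 :=
  if h : k.1 = k.2 then
    vertexPair (a := ψ (Sum.inl 0)) (b := ψ (Sum.inr (k.1, f k.1))) (by simp)
  else
    vertexPair (a := ψ (Sum.inr (k.1, f k.1))) (b := ψ (Sum.inr (k.2, f k.2))) (by simp [h])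

/-- The pair that must be presented in the completion phase `l` for the structure `f`. -/
def secondPair (ψ : Fin 2 ⊕ Fin 4 × Fin L ↪ Fin n) (l : Fin 4) (f : Fin 4 → Fin L) :
    VertexSet n 2 :=
  vertexPair (a := ψ (Sum.inr (l + 1, f (l + 1)))) (b := ψ (Sum.inr (l + 2, f (l + 2)))) (by simp)

theorem firstPair_eq_iff (ψ : Fin 2 ⊕ Fin 4 × Fin L ↪ Fin n) (i j : Fin 4)
    (f g : Fin 4 → Fin L) :
    firstPair ψ (i, j) f = firstPair ψ (i, j) g ↔ f i = g i ∧ f j = g j := by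
  constructor
  · intro h
    unfold firstPair at h
    by_cases hij : i = j
    · subst hij
      simp only [dif_pos, vertexPair, Subtype.mk.injEq, Finset.ext_iff] at h
      have := (h (ψ (Sum.inr (i, f i)))).1 (by simp)
      simpa using this
    · simp only [dif_neg hij, vertexPair, Subtype.mk.injEq, Finset.ext_iff] at h
      have h1 := (h (ψ (Sum.inr (i, f i)))).1 (by simp)
      have h2 := (h (ψ (Sum.inr (j, f j)))).1 (by simp)
      simp only [Finset.mem_insert, Finset.mem_singleton, EmbeddingLike.apply_eq_iff_eq,
        Sum.inr.injEq, Prod.mk.injEq, true_and, hij, false_and, or_false, Ne.symm hij,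
        false_or] at h1 h2
      exact ⟨h1, h2⟩
  · rintro ⟨h1, h2⟩
    simp only [firstPair, h1, h2]

theorem two_le_agree_of_secondPair_eq (ψ : Fin 2 ⊕ Fin 4 × Fin L ↪ Fin n) (l : Fin 4)
    (f g : Fin 4 → Fin L) (h : secondPair ψ l f = secondPair ψ l g) :
    2 ≤ (agree f g).card := by
  simp only [secondPair, vertexPair, Subtype.mk.injEq, Finset.ext_iff] at h
  have h1 := (h (ψ (Sum.inr (l + 1, f (l + 1))))).1 (by simp)
  have h2 := (h (ψ (Sum.inr (l + 2, f (l + 2))))).1 (by simp)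
  simp at h1 h2
  have hsub : ({l + 1, l + 2} : Finset (Fin 4)) ⊆ agree f g := by
    intro i hi
    rw [mem_agree]
    rcases Finset.mem_insert.1 hi with rfl | hi
    · exact h1
    · rw [Finset.mem_singleton.1 hi]; exact h2
  have := Finset.card_le_card hsub
  rwa [Finset.card_pair (by simp)] at this

/-- The answers in the first sixteen phases. -/
def firstAnswer (ψ : Fin 2 ⊕ Fin 4 × Fin L ↪ Fin n) (k : Fin 4 × Fin 4) : VertexSet n (3 - 2) :=
  if k.1 < k.2 then vertexSingle (ψ (Sum.inl 0)) else vertexSingle (ψ (Sum.inl 1))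

open Classical in
/-- The answers in the completion phases: complete the isolated structure that contains the
presented pair. -/
noncomputable def secondAnswer (ψ : Fin 2 ⊕ Fin 4 × Fin L ↪ Fin n)
    (ω : Fin 4 × Fin 4 → Fin T → VertexSet n 2) (l : Fin 4) (U : VertexSet n 2) :
    VertexSet n (3 - 2) :=
  if h : ∃ f, IsIsolated (firstPair ψ) ω f ∧ secondPair ψ l f = U then
    vertexSingle (ψ (Sum.inr (l + 3, h.choose (l + 3))))
  else vertexSingle (ψ (Sum.inl 0))

/-- Two isolated survivors needing the same pair would share two coordinates, so the chosen
structure can only be f. -/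
theorem secondAnswer_eq (ψ : Fin 2 ⊕ Fin 4 × Fin L ↪ Fin n)
    {ω : Fin 4 × Fin 4 → Fin T → VertexSet n 2} (l : Fin 4) {f : Fin 4 → Fin L}
    (hf : IsIsolated (firstPair ψ) ω f) :
    secondAnswer ψ ω l (secondPair ψ l f) = vertexSingle (ψ (Sum.inr (l + 3, f (l + 3)))) := by
  have hex : ∃ g, IsIsolated (firstPair ψ) ω g ∧ secondPair ψ l g = secondPair ψ l f :=
    ⟨f, hf, rfl⟩
  have : hex.choose = f := by
    obtain ⟨h1, h2⟩ := hex.choose_spec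
    by_contra hne
    have := two_le_agree_of_secondPair_eq ψ l _ _ h2.symm
    have := hf.2 _ hne h1.1
    omega
  rw [secondAnswer, dif_pos hex, this]

/-- The 4 + 6 + 6 + 4 edges, each written as presented pair then reply, matching diagonal phases,
phases above and below the diagonal, and completion phases. In the last family l is the omitted
class, with indices modulo 4. -/
theorem clique_edge_cases : ∀ e ∈ (clique 6 3).edges,
    (∃ i : Fin 4, e.val = {Fin.castAdd 4 (0 : Fin 2), Fin.natAdd (m := 4) 2 i, Fin.castAdd 4 (1 : Fin 2)}) ∨
    (∃ i j : Fin 4, i < j ∧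
      e.val = {Fin.natAdd (m := 4) 2 i, Fin.natAdd (m := 4) 2 j, Fin.castAdd 4 (0 : Fin 2)}) ∨
    (∃ i j : Fin 4, i < j ∧
      e.val = {Fin.natAdd (m := 4) 2 j, Fin.natAdd (m := 4) 2 i, Fin.castAdd 4 (1 : Fin 2)}) ∨
    ∃ l : Fin 4, e.val =
      {Fin.natAdd (m := 4) 2 (l + 1), Fin.natAdd (m := 4) 2 (l + 2), Fin.natAdd (m := 4) 2 (l + 3)} := by
  decide

theorem containsCopy_of_success (ψ : Fin 2 ⊕ Fin 4 × Fin L ↪ Fin n)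
    {ω : Fin 4 × Fin 4 → Fin T → VertexSet n 2} {ω' : Fin 4 → Fin T → VertexSet n 2}
    (hs : Success (firstPair ψ) (secondPair ψ) ω ω') {h : History 2 3 n}
    (h1 : ∀ k t, (ω k t, firstAnswer ψ k) ∈ h)
    (h2 : ∀ l t, (ω' l t, secondAnswer ψ ω l (ω' l t)) ∈ h) :
    h.graph ∈ containsCopy (clique 6 3) n := by
  obtain ⟨f, hf, hf'⟩ := hs
  have hfirst : ∀ k, (firstPair ψ k f, firstAnswer ψ k) ∈ h := fun k => by
    obtain ⟨t, ht⟩ := exists_eq_of_survive_ne_zero hf.1 k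
    exact ht ▸ h1 k t
  have hsecond : ∀ l, (secondPair ψ l f, vertexSingle (ψ (Sum.inr (l + 3, f (l + 3))))) ∈ h :=
    fun l => by
      obtain ⟨t, ht⟩ := exists_eq_of_survive_ne_zero hf' l
      have := h2 l t
      rwa [ht, secondAnswer_eq ψ l hf] at this
  let φ : Fin 6 → Fin n := fun v =>
    ψ (Sum.map id (fun i => (i, f i)) ((finSumFinEquiv (m := 2) (n := 4)).symm v))
  have hl : ∀ s : Fin 2, φ (Fin.castAdd 4 s) = ψ (Sum.inl s) := fun s => by
    simp only [φ, finSumFinEquiv_symm_apply_castAdd]; rfl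
  have hr : ∀ i : Fin 4, φ (Fin.natAdd 2 i) = ψ (Sum.inr (i, f i)) := fun i => by
    simp only [φ, finSumFinEquiv_symm_apply_natAdd]; rfl
  refine ⟨φ, ?_, fun e he => ?_⟩
  · refine ψ.injective.comp (Function.Injective.comp ?_ (Equiv.injective _))
    refine Function.injective_id.sumMap fun i j hij => ?_
    exact (Prod.mk.inj hij).1
  · rcases clique_edge_cases e he with ⟨i, h⟩ | ⟨i, j, hij, h⟩ | ⟨i, j, hij, h⟩ | ⟨l, h⟩
    · have := hfirst (i, i)
      rw [h]
      simp only [Multiset.insert_eq_cons, Multiset.map_cons, Multiset.map_singleton, hl, hr]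
      simp only [firstPair, firstAnswer, dif_pos, lt_irrefl, if_false] at this
      exact mem_graph_of_mem _ this
    · have := hfirst (i, j)
      rw [h]
      simp only [Multiset.insert_eq_cons, Multiset.map_cons, Multiset.map_singleton, hl, hr]
      simp only [firstPair, firstAnswer, dif_neg hij.ne, hij, if_true] at this
      exact mem_graph_of_mem _ this
    · have := hfirst (j, i)
      rw [h]
      simp only [Multiset.insert_eq_cons, Multiset.map_cons, Multiset.map_singleton, hl, hr]
      simp only [firstPair, firstAnswer, dif_neg hij.ne', hij.le.not_gt, if_false] at this
      exact mem_graph_of_mem _ this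
    · rw [h]
      simp only [Multiset.insert_eq_cons, Multiset.map_cons, Multiset.map_singleton, hr]
      exact mem_graph_of_mem _ (hsecond l)

/-- A strategy that succeeds within `20 * T` rounds, with an explicit bound on the error. -/
theorem exists_strategy_clique (hn : 2 ≤ n) (hL : 0 < L) (hLn : 2 + 4 * L ≤ n)
    (hρ : 0 < hitProb (n.choose 2) T) :
    ∃ S : Strategy 2 3 n, ENNReal.ofReal (1 - (12 * (L * hitProb (n.choose 2) T ^ 6) ^ 2 +
        8 * (L * hitProb (n.choose 2) T ^ 7) +
        4 * (L * hitProb (n.choose 2) T)⁻¹ + ((L * hitProb (n.choose 2) T ^ 5) ^ 4)⁻¹)) ≤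
      (graphLaw hn S (20 * T)).toOuterMeasure (containsCopy (clique 6 3) n) := by
  classical
  have := VertexSet.nonempty hn
  obtain ⟨ψ⟩ : Nonempty (Fin 2 ⊕ Fin 4 × Fin L ↪ Fin n) :=
    Function.Embedding.nonempty_of_card_le (by simpa using hLn)
  set G : History 2 3 n → ℝ :=
    Set.indicator (History.graph ⁻¹' containsCopy (clique 6 3) n) 1 with hG
  have hG0 : ∀ h, 0 ≤ G h := fun h => Set.indicator_nonneg (fun _ _ => zero_le_one) _
  obtain ⟨S, hS⟩ := exists_strategy_value_le (s := 3) hn (by omega) hG0 (20 * T)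
  refine ⟨S, ?_⟩
  rw [toOuterMeasure_graphLaw]
  refine le_trans (ENNReal.ofReal_le_ofReal ?_) hS
  have hcard : Fintype.card (VertexSet n 2) = n.choose 2 := by
    rw [Fintype.card_finset_len, Fintype.card_fin]
  have hlow := le_expect_success (P := VertexSet n 2) (T := T) (firstPair_eq_iff ψ)
    (two_le_agree_of_secondPair_eq ψ) hL (by rwa [hcard])
  rw [hcard] at hlow
  refine hlow.trans ?_
  have e20 : 20 * T = Fintype.card ((Fin 4 × Fin 4) × Fin T) + Fintype.card (Fin 4 × Fin T) := by
    simp; ring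
  rw [e20, value_add, ← Fintype.expect_equiv (Equiv.curry (Fin 4 × Fin 4) (Fin T) (VertexSet n 2))
    _ _ fun ω => rfl]
  refine expect_le_value (fun k _ => firstAnswer ψ k.1) _ _ _ fun ω h _ hω => ?_
  rw [← Fintype.expect_equiv (Equiv.curry (Fin 4) (Fin T) (VertexSet n 2)) _ _ fun ω => rfl]
  -- Replies may depend on `ω` here: the remaining value is taken from a history in which the first
  -- 16 T moves have already been played.
  refine expect_le_value (fun l U => secondAnswer ψ (Function.curry ω) l.1 U) _ _ _
    fun ω' h' hh hω' => ?_
  split_ifs with hs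
  · have hmem := containsCopy_of_success ψ hs (h := h') (fun k t => hh (hω (k, t)))
      fun l t => hω' (l, t)
    rw [hG, Set.indicator_of_mem (by exact hmem)]
    simp
  · exact hG0 h'

end Game

/-! ### From bounds on success probability to exponents -/

section Asymptotics

theorem optimalTime_le {r s n : ℕ} (hn : r ≤ n) (S : Strategy r s n) {A : GraphProperty} {q : ℝ}
    {t : ℕ} (h : ENNReal.ofReal q ≤ (graphLaw hn S t).toOuterMeasure (A n)) :
    optimalTime r s A q n ≤ t :=
  (iInf₂_le hn S).trans (iInf₂_le t h)

theorem growthExponent_le {r s : ℕ} {A : GraphProperty} {q x : ℝ}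
    (h : ∀ᶠ n : ℕ in atTop, ∃ t : ℕ, (t : ℝ) ≤ (n : ℝ) ^ x ∧ optimalTime r s A q n ≤ t) :
    growthExponent r s A q ≤ (x : EReal) := by
  refine limsup_le_of_le (by isBoundedDefault) ?_
  filter_upwards [h, eventually_ge_atTop 2] with n ⟨t, ht, hopt⟩ hn
  have hn' : (1 : ℝ) < n := by exact_mod_cast hn
  have hlog : 0 < Real.log n := Real.log_pos hn'
  rw [EReal.div_le_iff_le_mul (by exact_mod_cast hlog) (EReal.coe_ne_top _)]
  have h1 : (optimalTime r s A q n : ENNReal) ≤ ENNReal.ofReal ((n : ℝ) ^ x) := by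
    refine (ENat.toENNReal_le.2 hopt).trans ?_
    rw [ENat.toENNReal_coe, ← ENNReal.ofReal_natCast]
    exact ENNReal.ofReal_le_ofReal ht
  refine (ENNReal.log_monotone h1).trans (le_of_eq ?_)
  rw [ENNReal.log_ofReal_of_pos (Real.rpow_pos_of_pos (by linarith) x),
    Real.log_rpow (by linarith)]
  rw [mul_comm]
  norm_cast

theorem thresholdExponent_le {r s : ℕ} {A : GraphProperty} {x : EReal}
    (h : ∀ q < 1, growthExponent r s A q ≤ x) : thresholdExponent r s A ≤ x :=
  le_of_tendsto (tendsto_growthExponent r s A) <| by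
    filter_upwards [self_mem_nhdsWithin] with q hq using h q hq

/-- The error of the strategy vanishes when `T` is a bit larger than `n ^ (9 / 5)`. -/
theorem tendsto_error {L : ℕ → ℝ} {ρ : ℕ → ℝ} (hρ0 : ∀ᶠ n in atTop, 0 < ρ n)
    (hρ1 : ∀ᶠ n in atTop, ρ n ≤ 1) (hL : ∀ᶠ n in atTop, 0 < L n)
    (h5 : Tendsto (fun n => L n * ρ n ^ 5) atTop atTop)
    (h6 : Tendsto (fun n => L n * ρ n ^ 6) atTop (𝓝 0)) :
    Tendsto (fun n => 1 - (12 * (L n * ρ n ^ 6) ^ 2 + 8 * (L n * ρ n ^ 7) +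
      4 * (L n * ρ n)⁻¹ + ((L n * ρ n ^ 5) ^ 4)⁻¹)) atTop (𝓝 1) := by
  -- Since ρ ≤ 1, the powers 7 and 1 are controlled by the powers 6 and 5.
  have h7 : Tendsto (fun n => L n * ρ n ^ 7) atTop (𝓝 0) := by
    refine tendsto_of_tendsto_of_tendsto_of_le_of_le' tendsto_const_nhds h6 ?_ ?_
    · filter_upwards [hρ0, hL] with n h1 h2
      positivity
    · filter_upwards [hρ0, hρ1, hL] with n h1 h2 h3
      exact mul_le_mul_of_nonneg_left (pow_le_pow_of_le_one h1.le h2 (by norm_num)) h3.le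
  have h1 : Tendsto (fun n => L n * ρ n) atTop atTop := by
    refine tendsto_atTop_mono' _ ?_ h5
    filter_upwards [hρ0, hρ1, hL] with n h1 h2 h3
    exact mul_le_mul_of_nonneg_left (pow_le_of_le_one h1.le h2 (by norm_num)) h3.le
  have h20 : Tendsto (fun n => ((L n * ρ n ^ 5) ^ 4)⁻¹) atTop (𝓝 0) :=
    tendsto_inv_atTop_zero.comp ((tendsto_pow_atTop (by norm_num)).comp h5)
  have := tendsto_const_nhds (x := (1 : ℝ)) (f := atTop (α := ℕ)) |>.sub
    ((((h6.pow 2).const_mul 12).add (h7.const_mul 8)).add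
      ((tendsto_inv_atTop_zero.comp h1).const_mul 4) |>.add h20)
  simpa using this

end Asymptotics

/-! ### Choice of parameters and growth rates -/

section Rates

theorem tendsto_rpow_natCast {x : ℝ} (hx : 0 < x) :
    Tendsto (fun n : ℕ => (n : ℝ) ^ x) atTop atTop :=
  (tendsto_rpow_atTop hx).comp tendsto_natCast_atTop_atTop

theorem le_four_mul_choose_two {n : ℕ} (hn : 2 ≤ n) :
    (n : ℝ) ^ 2 ≤ 4 * (n.choose 2 : ℝ) := by
  have : (2 : ℝ) ≤ n := by exact_mod_cast hn
  rw [Nat.cast_choose_two]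
  nlinarith

theorem two_mul_choose_two_le (n : ℕ) : 2 * (n.choose 2 : ℝ) ≤ (n : ℝ) ^ 2 := by
  have : (0 : ℝ) ≤ n := Nat.cast_nonneg n
  rw [Nat.cast_choose_two]
  nlinarith

theorem ceil_rpow_le {n : ℕ} (hn : 1 ≤ n) {y : ℝ} (hy : 0 ≤ y) :
    (⌈(n : ℝ) ^ y⌉₊ : ℝ) ≤ 2 * (n : ℝ) ^ y := by
  have h1 : (1 : ℝ) ≤ (n : ℝ) ^ y := Real.one_le_rpow (by exact_mod_cast hn) hy
  have := (Nat.ceil_lt_add_one (by linarith : 0 ≤ (n : ℝ) ^ y)).le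
  linarith

variable {η : ℝ}

/-- The constant 8 is a factor 2 from rounding up times a factor 4 from `le_four_mul_choose_two`. -/
theorem hitProb_rate_le (hη : 0 < η) {n : ℕ} (hn : 2 ≤ n) :
    hitProb (n.choose 2) ⌈(n : ℝ) ^ (9 / 5 + η)⌉₊ ≤ 8 * (n : ℝ) ^ (-(1 / 5) + η) := by
  have hn0 : (0 : ℝ) < n := by exact_mod_cast (by omega : 0 < n)
  have hM := Nat.choose_pos hn
  have hM' : (0 : ℝ) < n.choose 2 := by exact_mod_cast hM
  refine (hitProb_le hM _).trans ?_
  rw [div_le_iff₀ hM']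
  refine (ceil_rpow_le (by omega) (by linarith)).trans ?_
  have h1 : (n : ℝ) ^ (9 / 5 + η) = (n : ℝ) ^ (-(1 / 5) + η) * (n : ℝ) ^ 2 := by
    rw [← Real.rpow_natCast, ← Real.rpow_add hn0]; norm_num; ring_nf
  rw [h1]
  have h2 := mul_le_mul_of_nonneg_left (le_four_mul_choose_two hn)
    (Real.rpow_nonneg hn0.le (-(1 / 5) + η))
  linarith

/-- No constant is lost: the 1 / 2 in `le_hitProb` cancels against the bound n ^ 2 / 2 on the number
of pairs. -/
theorem le_hitProb_rate {n : ℕ} (hn : 2 ≤ n)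
    (hT : ⌈(n : ℝ) ^ (9 / 5 + η)⌉₊ ≤ n.choose 2) :
    (n : ℝ) ^ (-(1 / 5) + η) ≤ hitProb (n.choose 2) ⌈(n : ℝ) ^ (9 / 5 + η)⌉₊ := by
  have hn0 : (0 : ℝ) < n := by exact_mod_cast (by omega : 0 < n)
  have hM := Nat.choose_pos hn
  have hM' : (0 : ℝ) < n.choose 2 := by exact_mod_cast hM
  refine le_trans ?_ (le_hitProb hM hT)
  rw [div_div, le_div_iff₀ (by positivity)]
  refine le_trans ?_ (Nat.le_ceil _)
  have h1 : (n : ℝ) ^ (9 / 5 + η) = (n : ℝ) ^ (-(1 / 5) + η) * (n : ℝ) ^ 2 := by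
    rw [← Real.rpow_natCast, ← Real.rpow_add hn0]; norm_num; ring_nf
  rw [h1]
  refine mul_le_mul_of_nonneg_left ?_ (Real.rpow_nonneg hn0.le _)
  linarith [two_mul_choose_two_le n]

theorem eventually_ceil_le_choose (h' : η < 1 / 5) (hη : 0 < η) :
    ∀ᶠ n : ℕ in atTop, ⌈(n : ℝ) ^ (9 / 5 + η)⌉₊ ≤ n.choose 2 := by
  filter_upwards [(tendsto_rpow_natCast (x := 1 / 5 - η) (by linarith)).eventually_ge_atTop 8,
    eventually_ge_atTop 2] with n h hn
  have hn0 : (0 : ℝ) < n := by exact_mod_cast (by omega : 0 < n)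
  have h1 : (n : ℝ) ^ 2 = (n : ℝ) ^ (9 / 5 + η) * (n : ℝ) ^ (1 / 5 - η) := by
    rw [← Real.rpow_natCast, ← Real.rpow_add hn0]; norm_num
  have h2 := mul_le_mul_of_nonneg_left h (Real.rpow_nonneg hn0.le (9 / 5 + η))
  have h3 := le_four_mul_choose_two hn
  have h4 := ceil_rpow_le (n := n) (by omega) (by linarith : 0 ≤ 9 / 5 + η)
  have : (⌈(n : ℝ) ^ (9 / 5 + η)⌉₊ : ℝ) ≤ n.choose 2 := by linarith
  exact_mod_cast this

theorem growthExponent_clique_le (hη : 0 < η) (h' : η < 1 / 30) {q : ℝ} (hq : q < 1) :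
    growthExponent 2 3 (containsCopy (clique 6 3)) q ≤ ((9 / 5 + 2 * η : ℝ) : EReal) := by
  set ρ : ℕ → ℝ := fun n => hitProb (n.choose 2) ⌈(n : ℝ) ^ (9 / 5 + η)⌉₊ with hρ
  -- The largest class size for which a, b and four classes fit into n vertices.
  set L : ℕ → ℝ := fun n => (((n - 2) / 4 : ℕ) : ℝ) with hL
  have hρl : ∀ᶠ n : ℕ in atTop, (n : ℝ) ^ (-(1 / 5) + η) ≤ ρ n := by
    filter_upwards [eventually_ceil_le_choose (by linarith) hη, eventually_ge_atTop 2] with n h hn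
      using le_hitProb_rate hn h
  have hρ0 : ∀ᶠ n in atTop, 0 < ρ n := by
    filter_upwards [hρl, eventually_ge_atTop 1] with n h hn
    exact (Real.rpow_pos_of_pos (by exact_mod_cast hn) _).trans_le h
  have hLl : ∀ᶠ n : ℕ in atTop, (n : ℝ) / 8 ≤ L n := by
    filter_upwards [eventually_ge_atTop 10] with n hn
    have : n ≤ 8 * ((n - 2) / 4) := by omega
    have : (n : ℝ) ≤ 8 * L n := by simp only [hL]; exact_mod_cast this
    linarith
  have hL0 : ∀ᶠ n in atTop, 0 < L n := by
    filter_upwards [hLl, eventually_ge_atTop 1] with n h hn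
    have : (1 : ℝ) ≤ n := by exact_mod_cast hn
    linarith
  have hρ1 : ∀ᶠ n in atTop, ρ n ≤ 1 := by
    filter_upwards [eventually_ge_atTop 2] with n hn using hitProb_le_one (Nat.choose_pos hn) _
  have h5 : Tendsto (fun n => L n * ρ n ^ 5) atTop atTop := by
    have := (tendsto_rpow_natCast (x := 5 * η) (by linarith)).atTop_div_const
      (by norm_num : (0 : ℝ) < 8)
    refine tendsto_atTop_mono' _ ?_ this
    filter_upwards [hρl, hLl, eventually_ge_atTop 1] with n h1 h2 hn
    have hn0 : (0 : ℝ) < n := by exact_mod_cast hn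
    calc (n : ℝ) ^ (5 * η) / 8 = n / 8 * ((n : ℝ) ^ (-(1 / 5) + η)) ^ 5 := by
          rw [← Real.rpow_natCast, ← Real.rpow_mul hn0.le]
          have : (5 * η) = 1 + (-(1 / 5) + η) * (5 : ℕ) := by push_cast; ring
          rw [this, Real.rpow_add hn0, Real.rpow_one]; ring
      _ ≤ _ := mul_le_mul h2 (pow_le_pow_left₀ (Real.rpow_nonneg hn0.le _) h1 5)
        (by positivity) ((by positivity : (0 : ℝ) ≤ n / 8).trans h2)
  have h6 : Tendsto (fun n => L n * ρ n ^ 6) atTop (𝓝 0) := by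
    -- L ρ ^ 6 has order at most n ^ (-1 / 5 + 6 η), which is where η < 1 / 30 is needed.
    have := ((tendsto_rpow_neg_atTop (y := 1 / 5 - 6 * η) (by linarith)).comp
      tendsto_natCast_atTop_atTop).const_mul ((8 : ℝ) ^ 6)
    rw [mul_zero] at this
    refine tendsto_of_tendsto_of_tendsto_of_le_of_le' tendsto_const_nhds this ?_ ?_
    · filter_upwards [hρ0, hL0] with n h1 h2
      positivity
    · filter_upwards [hρ0, eventually_ge_atTop 2] with n h1 hn
      have hn0 : (0 : ℝ) < n := by exact_mod_cast (by omega : 0 < n)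
      have hLn : L n ≤ n := by
        have : (n - 2) / 4 ≤ n := by omega
        simp only [hL]; exact_mod_cast this
      calc L n * ρ n ^ 6 ≤ n * (8 * (n : ℝ) ^ (-(1 / 5) + η)) ^ 6 :=
            mul_le_mul hLn (pow_le_pow_left₀ h1.le (hitProb_rate_le hη hn) 6) (by positivity)
              hn0.le
        _ = _ := by
          rw [mul_pow, ← Real.rpow_natCast ((n : ℝ) ^ _), ← Real.rpow_mul hn0.le,
            Function.comp]
          have : -(1 / 5 - 6 * η) = 1 + (-(1 / 5) + η) * (6 : ℕ) := by push_cast; ring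
          rw [this, Real.rpow_add hn0, Real.rpow_one]; ring
  refine growthExponent_le ?_
  -- The second η in the exponent absorbs the constant 40: twenty phases, times 2 for rounding up.
  filter_upwards [(tendsto_error hρ0 hρ1 hL0 h5 h6).eventually_const_le hq, hρ0,
    (tendsto_rpow_natCast hη).eventually_ge_atTop 40, eventually_ge_atTop 6]
    with n herr h0 h40 hn
  have hn0 : (0 : ℝ) < n := by exact_mod_cast (by omega : 0 < n)
  refine ⟨20 * ⌈(n : ℝ) ^ (9 / 5 + η)⌉₊, ?_, ?_⟩
  · have h4 := ceil_rpow_le (n := n) (by omega) (by linarith : 0 ≤ 9 / 5 + η)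
    have h5 : (n : ℝ) ^ (9 / 5 + 2 * η) = (n : ℝ) ^ (9 / 5 + η) * (n : ℝ) ^ η := by
      rw [← Real.rpow_add hn0]; ring_nf
    have h6 := mul_le_mul_of_nonneg_left h40 (Real.rpow_nonneg hn0.le (9 / 5 + η))
    push_cast
    linarith
  · obtain ⟨S, hS⟩ := exists_strategy_clique (n := n) (L := (n - 2) / 4) (by omega)
      (by omega) (by omega) h0
    exact optimalTime_le _ S ((ENNReal.ofReal_le_ofReal herr).trans hS)

end Rates

end SemiRandom

theorem mainTheorem10 :
    SemiRandom.thresholdExponent 2 3 (SemiRandom.containsCopy (SemiRandom.clique 6 3)) ≤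
      ((9 / 5 : ℝ) : EReal) := by
  refine SemiRandom.thresholdExponent_le fun q hq => le_of_forall_gt_imp_ge_of_dense fun c hc => ?_
  obtain ⟨y, hy, hyc⟩ := EReal.lt_iff_exists_real_btwn.1 hc
  have hy' : (9 / 5 : ℝ) < y := by exact_mod_cast hy
  -- Half the gap keeps 9 / 5 + 2 η below y; the cap 1 / 40 keeps η below 1 / 30.
  have hη : 0 < min ((y - 9 / 5) / 2) (1 / 40) := lt_min (by linarith) (by norm_num)
  refine (SemiRandom.growthExponent_clique_le hη
    ((min_le_right _ _).trans_lt (by norm_num)) hq).trans (le_trans ?_ hyc.le)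
  have := min_le_left ((y - 9 / 5) / 2) (1 / 40)
  exact_mod_cast (by linarith : 9 / 5 + 2 * min ((y - 9 / 5) / 2) (1 / 40) ≤ y)
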